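/- Let $d,m\ge 0$ be integers, and let $\mathbb{T}^m=(\mathbb{R}/2\pi\mathbb{Z})^m$. A function on $\mathbb{T}^m$ with values in a finite-dimensional normed space is called *piecewise smooth* if $\mathbb{T}^m$ is covered by countably many pieces, each with a boundary of Lebesgue measure zero, on each of which the function coincides with a $C^\infty$ function defined on an open neighbourhood of the piece (in the angular coordinates). A Hamiltonian $H:\mathbb{R}\to\mathbb{C}^{d\times d}$ is *$m$-time-quasiperiodic* with frequency vector $\omega\in\mathbb{R}^m$ if $\omega$ is rationally independent (the only $n\in\mathbb{Z}^m$ with $n\cdot\omega=0$ is $n=0$), if $H(t)=\hat H(\omega t)$ for all $t\in\mathbb{R}$ for some piecewise-smooth, Hermitian-matrix-valued function $\hat H$ on $\mathbb{T}^m$, and if $m$ is the smallest number of tones for which such a representation of $H$ exists. **Theorem.** Let $H$ be an $m$-time-quasiperiodic Hamiltonian with frequency vector $\omega$, locally integrable in time, and let $U(t)$ be its unitary time-evolution operator, i.e. the solution of $i\,\partial_t U(t)=H(t)U(t)$, $U(0)=\mathbb{1}$ (in integrated form). Suppose that the dynamics has a piecewise-smooth quasienergy eigenstate: a piecewise-smooth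 function $\alpha$ from $\mathbb{T}^m$ to the unit vectors of $\mathbb{C}^d$ and a real number $q$ such that $$U(t)\,\alpha(0)=e^{-iqt}\,\alpha(\omega t)\qquad\text{for all } t\in\mathbb{R}.$$ If $m<2(d-1)$, then $H$ does not exhibit complete Hilbert-space ergodicity. That is, it is not the case that for every initial pure state $\psi_0\in\mathbb{P}(\mathbb{C}^d)=\{|v\rangle\langle v| : v\in\mathbb{C}^d,\ \|v\|=1\}$ the distribution of $U(t)\psi_0U(t)^\dagger$, with $t$ uniform in $[0,T]$, converges weakly as $T\to\infty$ to the unitarily invariant probability measure on $\mathbb{P}(\mathbb{C}^d)$, which is the distribution of $V\phi_0V^\dagger$ for any fixed pure state $\phi_0$ and a Haar-random unitary $V$. -/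

import Mathlib

open scoped Topology

namespace QuantumErgodicity

/-! ### Tori and piecewise-smooth functions -/

instance factTwoPiPos : Fact (0 < 2 * Real.pi) := ⟨Real.two_pi_pos⟩

/-- The `m`-dimensional torus, with angular coordinates modulo `2π`. -/
abbrev Torus (m : ℕ) : Type := Fin m → AddCircle (2 * Real.pi)

/-- The covering map from `ℝ^m` onto the torus, reducing each coordinate modulo `2π`. -/
noncomputable def toTorus {m : ℕ} (x : Fin m → ℝ) : Torus m := fun j => (x j : AddCircle (2 * Real.pi))

/-- A function on the torus is piecewise smooth if the torus is covered by countably many pieces,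
each with a boundary of measure zero, such that the restriction of the function to each piece
is smooth, that is, in the angular coordinates it coincides on the piece with a function which is
smooth on an open neighbourhood of the piece.
Finitely many pieces are allowed, since pieces may be empty. -/
def PiecewiseSmooth {m : ℕ} {E : Type*} [NormedAddCommGroup E] [NormedSpace ℝ E]
    (f : Torus m → E) : Prop :=
  ∃ A : ℕ → Set (Torus m),
    (⋃ i, A i) = Set.univ ∧
    (∀ i, MeasureTheory.volume (frontier (A i)) = 0) ∧
    ∀ i, ∃ (W : Set (Fin m → ℝ)) (g : (Fin m → ℝ) → E),
      IsOpen W ∧ toTorus ⁻¹' A i ⊆ W ∧ ContDiffOn ℝ (⊤ : ℕ∞) g W ∧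
      ∀ x, toTorus x ∈ A i → f (toTorus x) = g x

/-! ### Time-quasiperiodic Hamiltonians -/

/-- The frequencies `ω₁, …, ω_m` are rationally independent. -/
def RationallyIndependent {m : ℕ} (ω : Fin m → ℝ) : Prop :=
  ∀ n : Fin m → ℤ, ∑ j, (n j : ℝ) * ω j = 0 → n = 0

/-- The winding `ω t` on the torus. -/
noncomputable def winding {m : ℕ} (ω : Fin m → ℝ) (t : ℝ) : Torus m := toTorus (fun j => ω j * t)

/-- `H(t) = Ĥ(ω t)` for a piecewise-smooth parent Hamiltonian `Ĥ` on the `m`-torus and a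
rationally independent frequency vector `ω`. -/
def IsQuasiperiodicRepresentation {d m : ℕ} (H : ℝ → Matrix (Fin d) (Fin d) ℂ)
    (ω : Fin m → ℝ) (Hhat : Torus m → Matrix (Fin d) (Fin d) ℂ) : Prop :=
  RationallyIndependent ω ∧ (∀ θ, (Hhat θ).IsHermitian) ∧ 
    PiecewiseSmooth (fun θ i j => Hhat θ i j : Torus m → Fin d → Fin d → ℂ) ∧
    ∀ t, H t = Hhat (winding ω t)

/-- `H` is an `m`-time-quasiperiodic Hamiltonian with frequency vector `ω`: it has a parent
Hamiltonian on the `m`-torus, and `m` is the smallest number of tones for which this is possible. -/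
def IsTimeQuasiperiodic {d m : ℕ} (H : ℝ → Matrix (Fin d) (Fin d) ℂ) (ω : Fin m → ℝ) : Prop :=
  (∃ Hhat : Torus m → Matrix (Fin d) (Fin d) ℂ, IsQuasiperiodicRepresentation H ω Hhat) ∧
  ∀ m' : ℕ, m' < m → ¬ ∃ (ω' : Fin m' → ℝ) (Hhat : Torus m' → Matrix (Fin d) (Fin d) ℂ),
    IsQuasiperiodicRepresentation H ω' Hhat

/-- `U` is the time-evolution operator generated by `H`: the solution of the Schrödinger equation
`i ∂ₜ U(t) = H(t) U(t)`, `U(0) = 1`, in integrated form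
(for each matrix entry), as `H` need not be continuous in time. -/
structure IsEvolutionOperator {d : ℕ} (H : ℝ → Matrix (Fin d) (Fin d) ℂ)
    (U : ℝ → Matrix.unitaryGroup (Fin d) ℂ) : Prop where
  locallyIntegrable : ∀ (i j : Fin d) (a b : ℝ),
    IntervalIntegrable (fun t => H t i j) MeasureTheory.volume a b
  continuous : Continuous U
  schrodinger : ∀ (t : ℝ) (i j : Fin d), (U t : Matrix (Fin d) (Fin d) ℂ) i j =
    (1 : Matrix (Fin d) (Fin d) ℂ) i j -
      Complex.I * ∫ s in (0 : ℝ)..t, (H s * (U s : Matrix (Fin d) (Fin d) ℂ)) i j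

/-- `α` is a piecewise-smooth quasienergy eigenstate, with quasienergy `q`, of the dynamics `U`
driven with frequency vector `ω`: a piecewise-smooth state-valued function on the torus such that
the initial state `α(0)` evolves as `U(t) α(0) = e^{-iqt} α(ω t)`. -/
structure IsQuasienergyEigenstate {d m : ℕ} (U : ℝ → Matrix.unitaryGroup (Fin d) ℂ)
    (ω : Fin m → ℝ) (q : ℝ) (α : Torus m → EuclideanSpace ℂ (Fin d)) : Prop where
  norm_eq_one : ∀ θ, ‖α θ‖ = 1
  piecewiseSmooth : PiecewiseSmooth α
  evolution : ∀ t : ℝ,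
    Matrix.toEuclideanLin (U t : Matrix (Fin d) (Fin d) ℂ) (α 0) =
      Complex.exp (-(Complex.I * q * t)) • α (winding ω t)

/-! ### Pure states and complete Hilbert-space ergodicity -/

/-- The projective Hilbert space of `ℂ^d`: rank-one density matrices `|v⟩⟨v|` with `‖v‖ = 1`. -/
def PureState (d : ℕ) : Type :=
  {ψ : Matrix (Fin d) (Fin d) ℂ //
    ∃ v : EuclideanSpace ℂ (Fin d), ‖v‖ = 1 ∧ ψ = Matrix.vecMulVec v (star (v : Fin d → ℂ))}

instance (d : ℕ) : TopologicalSpace (PureState d) :=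
  inferInstanceAs (TopologicalSpace {ψ : Matrix (Fin d) (Fin d) ℂ //
    ∃ v : EuclideanSpace ℂ (Fin d), ‖v‖ = 1 ∧ ψ = Matrix.vecMulVec v (star (v : Fin d → ℂ))})

/-- The action `ψ ↦ V ψ V†` of a unitary on pure states. -/
noncomputable def PureState.conj {d : ℕ} (V : Matrix.unitaryGroup (Fin d) ℂ) (ψ : PureState d) : PureState d :=
  ⟨(V : Matrix (Fin d) (Fin d) ℂ) * ψ.1 * star (V : Matrix (Fin d) (Fin d) ℂ), by
    obtain ⟨v, hv, hψ⟩ := ψ.2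
    refine ⟨Matrix.toEuclideanLin (V : Matrix (Fin d) (Fin d) ℂ) v, ?_, ?_⟩
    · have h1 : star (V : Matrix (Fin d) (Fin d) ℂ) * (V : Matrix (Fin d) (Fin d) ℂ) = 1 :=
        Matrix.mem_unitaryGroup_iff'.1 V.2
      have h2 : inner ℂ (Matrix.toEuclideanLin (V : Matrix (Fin d) (Fin d) ℂ) v)
          (Matrix.toEuclideanLin (V : Matrix (Fin d) (Fin d) ℂ) v) = inner ℂ v v := by
        rw [← LinearMap.adjoint_inner_right, ← Matrix.toEuclideanLin_conjTranspose_eq_adjoint,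
          ← Matrix.star_eq_conjTranspose]
        congr 1
        ext i
        simp [Matrix.toLpLin_apply, Matrix.mulVec_mulVec, h1]
      rw [inner_self_eq_norm_sq_to_K, inner_self_eq_norm_sq_to_K, hv] at h2
      have h3 : ‖Matrix.toEuclideanLin (V : Matrix (Fin d) (Fin d) ℂ) v‖ ^ 2 = 1 := by
        have := congrArg (fun z : ℂ => ‖z‖) h2
        simpa using this
      nlinarith [norm_nonneg (Matrix.toEuclideanLin (V : Matrix (Fin d) (Fin d) ℂ) v)]
    · rw [hψ, Matrix.mul_vecMulVec, Matrix.vecMulVec_mul]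
      simp [Matrix.toLpLin_apply, Matrix.star_mulVec, Matrix.star_eq_conjTranspose]⟩

instance compactSpace_unitaryGroup (d : ℕ) : CompactSpace (Matrix.unitaryGroup (Fin d) ℂ) := by
  apply isCompact_iff_compactSpace.mp
  have hK : IsCompact (Set.pi Set.univ fun _ : Fin d => Set.pi Set.univ fun _ : Fin d =>
      Metric.closedBall (0 : ℂ) 1) :=
    isCompact_univ_pi fun _ => isCompact_univ_pi fun _ => isCompact_closedBall 0 1
  refine IsCompact.of_isClosed_subset (X := Matrix (Fin d) (Fin d) ℂ) hK ?_ ?_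
  · have : ((Matrix.unitaryGroup (Fin d) ℂ : Submonoid (Matrix (Fin d) (Fin d) ℂ)) :
        Set (Matrix (Fin d) (Fin d) ℂ)) = {A | A * star A = 1} := by
      ext A
      exact Matrix.mem_unitaryGroup_iff
    rw [this]
    exact isClosed_eq (by fun_prop) continuous_const
  · intro A hA i _ j _
    simpa using entry_norm_bound_of_unitary hA i j

noncomputable instance measurableSpace_unitaryGroup (d : ℕ) :
    MeasurableSpace (Matrix.unitaryGroup (Fin d) ℂ) := borel _

instance borelSpace_unitaryGroup (d : ℕ) : BorelSpace (Matrix.unitaryGroup (Fin d) ℂ) := ⟨rfl⟩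

/-- The Haar probability measure on the unitary group `U(d)`. -/
noncomputable def haarUnitary (d : ℕ) : MeasureTheory.Measure (Matrix.unitaryGroup (Fin d) ℂ) :=
  MeasureTheory.Measure.haarMeasure ⊤

/-- The average of `F` over the spatial ensemble `{V φ₀ V†}` with `V` Haar distributed
(it does not depend on the reference state `φ₀`). -/
noncomputable def spatialAverage {d : ℕ} (φ₀ : PureState d) (F : PureState d → ℝ) : ℝ :=
  ∫ V, F (PureState.conj V φ₀) ∂(haarUnitary d)

/-- The average of `F` over the states visited up to time `T` starting from `ψ₀`. -/
noncomputable def timeAverage {d : ℕ} (U : ℝ → Matrix.unitaryGroup (Fin d) ℂ) (ψ₀ : PureState d)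
    (F : PureState d → ℝ) (T : ℝ) : ℝ :=
  T⁻¹ * ∫ t in (0 : ℝ)..T, F (PureState.conj (U t) ψ₀)

/-- Complete Hilbert-space ergodicity: for every initial state, the temporal ensemble, that is, the
limit in distribution of the states visited during `[0, T]` as `T → ∞`, exists and equals the
Haar-distributed spatial ensemble. -/
def ExhibitsCHSE {d : ℕ} (U : ℝ → Matrix.unitaryGroup (Fin d) ℂ) : Prop :=
  ∀ ψ₀ φ₀ : PureState d, ∀ F : C(PureState d, ℝ),
    Filter.Tendsto (timeAverage U ψ₀ F) Filter.atTop (𝓝 (spatialAverage φ₀ F))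

end QuantumErgodicity

open QuantumErgodicity

/-! The real dimension of $\mathbb{P}(\mathbb{C}^d)$ is $2(d-1)$, so a smooth image of an
$m$-dimensional set is too thin to carry any Haar mass. The orbit of $\alpha(0)$ is, up to phase,
$\alpha(\omega t)$.

Some piece of `α` has nonempty interior (`PiecewiseSmooth.exists_isOpen`); let $C$ be a closed ball
there and $K$ the set of states $|\alpha(\theta)\rangle\langle\alpha(\theta)|$, $\theta\in C$. By
Weyl equidistribution the orbit spends a positive fraction of time in $K$
(`exists_bump_average_winding`).

Restoring norm and phase turns $K$ into a complex cone of dimension at most $m+2<2d$, hence Lebesgue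
null (`hausdorffMeasure_cone_eq_zero`). Fubini over vectors and unitaries gives a vector whose
Haar-random image almost surely avoids the cone (`exists_ae_unitary_notMem`). As $K$ is closed,
continuous functions decreasing to its indicator show that the two ensembles differ
(`not_exhibitsCHSE_of_isClosed`). -/

namespace QuantumErgodicity

open MeasureTheory Filter

/-! ### Equidistribution of linear flows on the torus. -/

/-- The normalised Haar measure on the unit torus. -/
noncomputable def unitTorusHaar (m : ℕ) : Measure (UnitAddTorus (Fin m)) :=
  Measure.pi fun _ => AddCircle.haarAddCircle

instance (m : ℕ) : IsProbabilityMeasure (unitTorusHaar m) := by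
  unfold unitTorusHaar; infer_instance

instance (m : ℕ) : (unitTorusHaar m).IsOpenPosMeasure := by
  unfold unitTorusHaar; infer_instance

/-- Translation by half a period of the character changes its sign and preserves Haar measure. -/
theorem integral_fourier_eq_zero {k : ℤ} (hk : k ≠ 0) :
    ∫ x : UnitAddCircle, (fourier k x : ℂ) ∂AddCircle.haarAddCircle = 0 :=
  integral_eq_zero_of_add_right_eq_neg (μ := AddCircle.haarAddCircle)
    (fourier_add_half_inv_index hk one_pos)

theorem integral_mFourier_eq_zero {m : ℕ} {n : Fin m → ℤ} (hn : n ≠ 0) :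
    ∫ x, UnitAddTorus.mFourier n x ∂unitTorusHaar m = 0 := by
  obtain ⟨j, hj⟩ := Function.ne_iff.1 hn
  have h := integral_fintype_prod_eq_prod (𝕜 := ℂ) (E := fun _ : Fin m => UnitAddCircle)
    (f := fun i x => (fourier (n i) x : ℂ)) (μ := fun _ => AddCircle.haarAddCircle)
  exact h.trans (Finset.prod_eq_zero (Finset.mem_univ j) (integral_fourier_eq_zero hj))

/-- The linear flow on the unit torus with velocity `v`. -/
noncomputable def unitWinding {m : ℕ} (v : Fin m → ℝ) (t : ℝ) : UnitAddTorus (Fin m) :=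
  fun j => ((v j * t : ℝ) : UnitAddCircle)

theorem continuous_unitWinding {m : ℕ} (v : Fin m → ℝ) : Continuous (unitWinding v) :=
  continuous_pi fun j => (AddCircle.continuous_mk' 1).comp (by fun_prop)

theorem mFourier_unitWinding {m : ℕ} (v : Fin m → ℝ) (n : Fin m → ℤ) (t : ℝ) :
    UnitAddTorus.mFourier n (unitWinding v t) =
      Complex.exp ((2 * Real.pi * (∑ j, (n j : ℝ) * v j : ℝ) * Complex.I) * t) := by
  simp only [UnitAddTorus.mFourier, unitWinding, ContinuousMap.coe_mk, fourier_coe_apply]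
  rw [← Complex.exp_sum]
  congr 1
  push_cast
  rw [Finset.mul_sum, Finset.sum_mul, Finset.sum_mul]
  exact Finset.sum_congr rfl fun j _ => by ring

/-- The integral stays bounded by $2/|c|$ uniformly in $T$, so dividing by $T$ kills it. -/
theorem tendsto_average_exp {c : ℝ} (hc : c ≠ 0) :
    Tendsto (fun T : ℝ => (T : ℂ)⁻¹ * ∫ t in (0 : ℝ)..T, Complex.exp ((c * Complex.I) * t))
      atTop (𝓝 0) := by
  have hcI : (c : ℂ) * Complex.I ≠ 0 := by simp [hc]
  refine squeeze_zero_norm' (a := fun T : ℝ => T⁻¹ * (2 / |c|)) ?_ ?_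
  · filter_upwards [eventually_gt_atTop 0] with T hT
    rw [integral_exp_mul_complex hcI, norm_mul, norm_inv, Complex.norm_real,
      Real.norm_of_nonneg hT.le, norm_div, norm_mul, Complex.norm_I, Complex.norm_real, Real.norm_eq_abs, mul_one]
    gcongr
    refine (norm_sub_le _ _).trans ?_
    have h : (c : ℂ) * Complex.I * T = ((c * T : ℝ) : ℂ) * Complex.I := by push_cast; ring
    rw [h, Complex.norm_exp_ofReal_mul_I]
    norm_num
  · simpa using tendsto_inv_atTop_zero.mul_const (2 / |c|)

theorem tendsto_average_mFourier {m : ℕ} {v : Fin m → ℝ} (hv : RationallyIndependent v)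
    (n : Fin m → ℤ) :
    Tendsto (fun T : ℝ => (T : ℂ)⁻¹ * ∫ t in (0 : ℝ)..T,
      UnitAddTorus.mFourier n (unitWinding v t)) atTop
      (𝓝 (∫ x, UnitAddTorus.mFourier n x ∂unitTorusHaar m)) := by
  by_cases hn : n = 0
  · subst hn
    refine Tendsto.congr' ?_ tendsto_const_nhds
    filter_upwards [eventually_gt_atTop 0] with T hT
    have : (T : ℂ) ≠ 0 := by exact_mod_cast hT.ne'
    simp [UnitAddTorus.mFourier_zero, this]
  · rw [integral_mFourier_eq_zero hn]
    simp_rw [mFourier_unitWinding]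
    have hc : 2 * Real.pi * ∑ j, (n j : ℝ) * v j ≠ 0 :=
      mul_ne_zero (by positivity) fun h => hn (hv n h)
    simpa using tendsto_average_exp hc

theorem norm_average_le {f : ℝ → ℂ} {C T : ℝ} (hT : 0 < T) (hf : ∀ t, ‖f t‖ ≤ C) :
    ‖(T : ℂ)⁻¹ * ∫ t in (0 : ℝ)..T, f t‖ ≤ C := by
  have h := intervalIntegral.norm_integral_le_of_norm_le_const (a := 0) (b := T)
    (f := f) fun t _ => hf t
  rw [norm_mul, norm_inv, Complex.norm_real, Real.norm_of_nonneg hT.le, inv_mul_le_iff₀ hT]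
  rwa [sub_zero, abs_of_pos hT, mul_comm] at h

/-- Weyl's equidistribution theorem for linear flows on the torus. -/
theorem tendsto_average_unitWinding {m : ℕ} {v : Fin m → ℝ} (hv : RationallyIndependent v)
    (f : C(UnitAddTorus (Fin m), ℂ)) :
    Tendsto (fun T : ℝ => (T : ℂ)⁻¹ * ∫ t in (0 : ℝ)..T, f (unitWinding v t)) atTop
      (𝓝 (∫ x, f x ∂unitTorusHaar m)) := by
  have hii (g : C(UnitAddTorus (Fin m), ℂ)) (T : ℝ) :
      IntervalIntegrable (fun t => g (unitWinding v t)) volume 0 T :=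
    (g.continuous.comp (continuous_unitWinding v)).intervalIntegrable _ _
  have hfi (g : C(UnitAddTorus (Fin m), ℂ)) : Integrable g (unitTorusHaar m) :=
    g.continuous.integrable_of_hasCompactSupport (HasCompactSupport.of_compactSpace g)
  have hspan : ∀ g ∈ Submodule.span ℂ (Set.range (UnitAddTorus.mFourier (d := Fin m))),
      Tendsto (fun T : ℝ => (T : ℂ)⁻¹ * ∫ t in (0 : ℝ)..T, g (unitWinding v t)) atTop
        (𝓝 (∫ x, g x ∂unitTorusHaar m)) := by
    intro g hg
    induction hg using Submodule.span_induction with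
    | mem g hg => obtain ⟨n, rfl⟩ := hg; exact tendsto_average_mFourier hv n
    | zero => simp
    | add g₁ g₂ _ _ h₁ h₂ =>
      simp_rw [ContinuousMap.add_apply]
      rw [integral_add (hfi g₁) (hfi g₂)]
      refine (h₁.add h₂).congr fun T => ?_
      rw [intervalIntegral.integral_add (hii g₁ T) (hii g₂ T), mul_add]
    | smul a g _ h =>
      simp_rw [ContinuousMap.smul_apply, smul_eq_mul, intervalIntegral.integral_const_mul,
        integral_const_mul]
      refine (h.const_mul a).congr fun T => by ring
  rw [Metric.tendsto_nhds]
  intro ε hε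
  -- Trigonometric polynomials are uniformly dense, and both averages are contractions for the sup
  -- norm: an $\varepsilon/3$ argument.
  have hf : f ∈ (Submodule.span ℂ
      (Set.range (UnitAddTorus.mFourier (d := Fin m)))).topologicalClosure := by
    rw [UnitAddTorus.span_mFourier_closure_eq_top]; trivial
  obtain ⟨g, hg, hfg⟩ := Metric.mem_closure_iff.1 hf (ε / 3) (by positivity)
  have hbd (x : UnitAddTorus (Fin m)) : ‖f x - g x‖ ≤ ε / 3 := by
    rw [← dist_eq_norm]
    exact (ContinuousMap.dist_apply_le_dist x).trans hfg.le
  filter_upwards [Metric.tendsto_nhds.1 (hspan g hg) (ε / 3) (by positivity),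
    eventually_gt_atTop 0] with T hgT hT
  have h1 : ‖(T : ℂ)⁻¹ * ∫ t in (0 : ℝ)..T, (f (unitWinding v t) - g (unitWinding v t))‖ ≤ ε / 3 :=
    norm_average_le hT fun t => hbd _
  have h2 : ‖∫ x, (f x - g x) ∂unitTorusHaar m‖ ≤ ε / 3 := by
    simpa using norm_integral_le_of_norm_le_const (μ := unitTorusHaar m)
      (f := fun x => f x - g x) (Eventually.of_forall hbd)
  rw [intervalIntegral.integral_sub (hii f T) (hii g T), mul_sub] at h1
  rw [integral_sub (hfi f) (hfi g)] at h2
  rw [dist_eq_norm] at hgT ⊢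
  set a := (T : ℂ)⁻¹ * ∫ t in (0 : ℝ)..T, f (unitWinding v t)
  set b := (T : ℂ)⁻¹ * ∫ t in (0 : ℝ)..T, g (unitWinding v t)
  set a' := ∫ x, f x ∂unitTorusHaar m
  set b' := ∫ x, g x ∂unitTorusHaar m
  calc ‖a - a'‖ = ‖(a - b) + (b - b') - (a' - b')‖ := by congr 1; ring
    _ ≤ ‖a - b‖ + ‖b - b'‖ + ‖a' - b'‖ := (norm_sub_le _ _).trans (by gcongr; exact norm_add_le _ _)
    _ < ε := by linarith

/-- Rescaling of the angular coordinates to period one. -/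
noncomputable def torusHomeomorph (m : ℕ) : Torus m ≃ₜ UnitAddTorus (Fin m) :=
  Homeomorph.piCongrRight fun _ =>
    AddCircle.homeomorphAddCircle (2 * Real.pi) 1 Real.two_pi_pos.ne' one_ne_zero

theorem torusHomeomorph_winding {m : ℕ} (ω : Fin m → ℝ) (t : ℝ) :
    torusHomeomorph m (winding ω t) = unitWinding (fun j => ω j * (2 * Real.pi)⁻¹) t := by
  ext j
  change AddCircle.homeomorphAddCircle (2 * Real.pi) 1 _ _ ((ω j * t : ℝ) : AddCircle _) = _
  rw [AddCircle.homeomorphAddCircle_apply_mk]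
  simp only [unitWinding]
  congr 1
  ring

theorem continuous_winding {m : ℕ} (ω : Fin m → ℝ) : Continuous (winding ω) :=
  continuous_pi fun j => (AddCircle.continuous_mk' _).comp (by fun_prop)

/-- The winding visits every nonempty open set with positive frequency. -/
theorem exists_bump_average_winding {m : ℕ} {ω : Fin m → ℝ} (hω : RationallyIndependent ω)
    {B : Set (Torus m)} (hB : IsOpen B) (hne : B.Nonempty) :
    ∃ C ⊆ B, IsCompact C ∧ ∃ χ : Torus m → ℝ, Continuous χ ∧ (∀ x, χ x ≤ 1) ∧ (∀ x ∉ C, χ x = 0) ∧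
      ∃ c > 0, Tendsto (fun T : ℝ => T⁻¹ * ∫ t in (0 : ℝ)..T, χ (winding ω t)) atTop (𝓝 c) := by
  obtain ⟨x₀, hx₀⟩ := hne
  obtain ⟨r, hr, hrB⟩ := Metric.nhds_basis_closedBall.mem_iff.1 (hB.mem_nhds hx₀)
  -- A tent of height one at `x₀`, vanishing outside a closed ball; compactness of that ball later
  -- makes the set of states closed.
  let χ : Torus m → ℝ := fun x => max 0 (1 - dist x x₀ / r)
  have hχ : Continuous χ := by fun_prop
  refine ⟨Metric.closedBall x₀ r, hrB, isCompact_closedBall _ _, χ, hχ, fun x => ?_,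
    fun x hx => ?_, ?_⟩
  · exact max_le zero_le_one (sub_le_self _ (by positivity))
  · rw [Metric.mem_closedBall, not_le] at hx
    exact max_eq_left (sub_nonpos.2 ((one_le_div hr).2 hx.le))
  let f : UnitAddTorus (Fin m) → ℝ := χ ∘ (torusHomeomorph m).symm
  have hf : Continuous f := hχ.comp (torusHomeomorph m).symm.continuous
  refine ⟨∫ x, f x ∂unitTorusHaar m, ?_, ?_⟩
  -- The limit is positive because Haar measure charges open sets and the tent equals one at its
  -- centre.
  · refine hf.integral_pos_of_hasCompactSupport_nonneg_nonzero
      (HasCompactSupport.of_compactSpace f) (fun x => le_max_left _ _)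
      (x := torusHomeomorph m x₀) ?_
    simp [f, χ]
  · have hv : RationallyIndependent fun j => ω j * (2 * Real.pi)⁻¹ := by
      intro n hn
      refine hω n ?_
      simp_rw [← mul_assoc, ← Finset.sum_mul] at hn
      exact (mul_eq_zero.1 hn).resolve_right (by positivity)
    have h := tendsto_average_unitWinding hv ⟨fun x => (f x : ℂ), by fun_prop⟩
    simp only [ContinuousMap.coe_mk, intervalIntegral.integral_ofReal, integral_complex_ofReal] at h
    have h' := (Complex.continuous_re.tendsto _).comp h
    refine h'.congr fun T => ?_
    simp only [Function.comp_apply, ← Complex.ofReal_inv, ← Complex.ofReal_mul, Complex.ofReal_re,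
      ← torusHomeomorph_winding, f, Homeomorph.symm_apply_apply]

/-! ### Null cones and Haar-random vectors. -/

/-- The complex cone over the image of a smooth map from an open subset of `ℝ^m` is null
if `m + 2` is less than the real dimension of the target. -/
theorem hausdorffMeasure_cone_eq_zero {m : ℕ} {E : Type*} [NormedAddCommGroup E] [NormedSpace ℂ E]
    [MeasurableSpace E] [BorelSpace E] {W : Set (Fin m → ℝ)} (hW : IsOpen W)
    {g : (Fin m → ℝ) → E} (hg : ContDiffOn ℝ (⊤ : ℕ∞) g W) {k : ℕ} (hk : m + 2 < k) :
    Measure.hausdorffMeasure k ((fun p : ℂ × (Fin m → ℝ) => p.1 • g p.2) '' (Set.univ ×ˢ W)) = 0 := by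
  have hdim : dimH ((fun p : ℂ × (Fin m → ℝ) => p.1 • g p.2) '' (Set.univ ×ˢ W)) ≤
      (m + 2 : ℕ) := by
    -- A $C^1$ map is locally Lipschitz and so does not raise Hausdorff dimension; the source
    -- $\mathbb{C}\times\mathbb{R}^m$ has dimension $m+2$.
    refine (dimH_image_le_of_locally_lipschitzOn fun p hp => ?_).trans
      ((dimH_mono (Set.subset_univ _)).trans ?_)
    · have hgp : ContDiffAt ℝ 1 g p.2 :=
        (hg.contDiffAt (hW.mem_nhds hp.2)).of_le (by exact_mod_cast le_top)
      have h : ContDiffAt ℝ 1 (fun p : ℂ × (Fin m → ℝ) => p.1 • g p.2) p :=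
        contDiffAt_fst.smul (ContDiffAt.comp p hgp contDiffAt_snd)
      obtain ⟨K, t, ht, hL⟩ := h.exists_lipschitzOnWith
      exact ⟨K, t, mem_nhdsWithin_of_mem_nhds ht, hL⟩
    · rw [Real.dimH_univ_eq_finrank]
      simp [Complex.finrank_real_complex, add_comm]
  have h := hausdorffMeasure_of_dimH_lt (d := (k : NNReal))
    (hdim.trans_lt (by exact_mod_cast hk))
  simpa using h

theorem isometry_toEuclideanLin {d : ℕ} (V : Matrix.unitaryGroup (Fin d) ℂ) :
    Isometry (Matrix.toEuclideanLin (V : Matrix (Fin d) (Fin d) ℂ)) := by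
  refine AddMonoidHomClass.isometry_of_norm _ fun v => ?_
  have h1 : star (V : Matrix (Fin d) (Fin d) ℂ) * (V : Matrix (Fin d) (Fin d) ℂ) = 1 :=
    Matrix.mem_unitaryGroup_iff'.1 V.2
  have h2 : inner ℂ (Matrix.toEuclideanLin (V : Matrix (Fin d) (Fin d) ℂ) v)
      (Matrix.toEuclideanLin (V : Matrix (Fin d) (Fin d) ℂ) v) = inner ℂ v v := by
    rw [← LinearMap.adjoint_inner_right, ← Matrix.toEuclideanLin_conjTranspose_eq_adjoint,
      ← Matrix.star_eq_conjTranspose]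
    congr 1
    ext i
    simp [Matrix.toLpLin_apply, Matrix.mulVec_mulVec, h1]
  rw [inner_self_eq_norm_sq_to_K, inner_self_eq_norm_sq_to_K] at h2
  have h3 : ‖Matrix.toEuclideanLin (V : Matrix (Fin d) (Fin d) ℂ) v‖ ^ 2 = ‖v‖ ^ 2 := by
    exact_mod_cast h2
  exact (pow_left_inj₀ (norm_nonneg _) (norm_nonneg _) two_ne_zero).1 h3

theorem continuous_toEuclideanLin_unitary (d : ℕ) :
    Continuous fun p : Matrix.unitaryGroup (Fin d) ℂ × EuclideanSpace ℂ (Fin d) =>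
      Matrix.toEuclideanLin (p.1 : Matrix (Fin d) (Fin d) ℂ) p.2 := by
  simp only [Matrix.toLpLin_apply]
  refine (PiLp.continuous_toLp 2 _).comp ?_
  exact (continuous_subtype_val.comp continuous_fst).matrix_mulVec
    ((PiLp.continuous_ofLp 2 _).comp continuous_snd)

instance (d : ℕ) : IsProbabilityMeasure (haarUnitary d) :=
  ⟨by simpa [haarUnitary] using Measure.haarMeasure_self (K₀ := (⊤ : TopologicalSpace.PositiveCompacts
    (Matrix.unitaryGroup (Fin d) ℂ)))⟩

instance (d : ℕ) : SecondCountableTopology (Matrix.unitaryGroup (Fin d) ℂ) := by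
  have : SecondCountableTopology (Matrix (Fin d) (Fin d) ℂ) :=
    inferInstanceAs (SecondCountableTopology (Fin d → Fin d → ℂ))
  exact TopologicalSpace.Subtype.secondCountableTopology _

/-- For a Lebesgue-null measurable set `N`, there is a nonzero vector which a Haar-random unitary
almost surely maps outside `N`. -/
theorem exists_ae_unitary_notMem {d : ℕ} (hd : 0 < d) {N : Set (EuclideanSpace ℂ (Fin d))}
    (hN : MeasurableSet N) (h0 : Measure.hausdorffMeasure (2 * d : ℕ) N = 0) :
    ∃ v : EuclideanSpace ℂ (Fin d), v ≠ 0 ∧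
      ∀ᵐ V : Matrix.unitaryGroup (Fin d) ℂ ∂haarUnitary d,
        Matrix.toEuclideanLin (V : Matrix (Fin d) (Fin d) ℂ) v ∉ N := by
  -- Top-dimensional Hausdorff measure is a Haar measure on the vector space, and isometries visibly
  -- preserve it.
  let ν : Measure (EuclideanSpace ℂ (Fin d)) :=
    Measure.hausdorffMeasure (Module.finrank ℝ (EuclideanSpace ℂ (Fin d)))
  have hfin : Module.finrank ℝ (EuclideanSpace ℂ (Fin d)) = 2 * d := by
    rw [finrank_real_of_complex, finrank_euclideanSpace_fin]
  have : ν.IsAddHaarMeasure := isAddHaarMeasure_hausdorffMeasure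
  have hνN : ν N = 0 := by simpa only [ν, hfin] using h0
  have hmeas : MeasurableSet ((fun p : EuclideanSpace ℂ (Fin d) × Matrix.unitaryGroup (Fin d) ℂ =>
      Matrix.toEuclideanLin (p.2 : Matrix (Fin d) (Fin d) ℂ) p.1) ⁻¹' N) :=
    ((continuous_toEuclideanLin_unitary d).comp continuous_swap).measurable hN
  have hprod : (ν.prod (haarUnitary d))
      ((fun p : EuclideanSpace ℂ (Fin d) × Matrix.unitaryGroup (Fin d) ℂ =>
        Matrix.toEuclideanLin (p.2 : Matrix (Fin d) (Fin d) ℂ) p.1) ⁻¹' N) = 0 := by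
    -- Slicing at fixed `V` gives the preimage of `N` under an isometry, which is null; slicing the
    -- same null set at fixed `v` then gives the claim for almost every `v`.
    rw [← Measure.prod_swap, Measure.map_apply measurable_swap hmeas,
      Measure.measure_prod_null (measurable_swap hmeas)]
    refine Eventually.of_forall fun V => ?_
    refine le_antisymm (le_trans ?_ hνN.le) zero_le
    have h := (isometry_toEuclideanLin V).hausdorffMeasure_preimage
      (d := (Module.finrank ℝ (EuclideanSpace ℂ (Fin d)) : ℝ)) (Or.inl (by positivity)) N
    exact h.le.trans (measure_mono Set.inter_subset_left)
  have hae := Measure.measure_ae_null_of_prod_null hprod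
  have : Nontrivial (EuclideanSpace ℂ (Fin d)) := by
    have : Nonempty (Fin d) := ⟨⟨0, hd⟩⟩
    infer_instance
  have hne : ∀ᵐ v ∂ν, v ≠ 0 := by
    simp [ae_iff]
  obtain ⟨v, hv, hv0⟩ := (hae.and hne).exists
  refine ⟨v, hv0, ?_⟩
  rw [ae_iff]
  simp only [not_not]
  exact hv

/-! ### Pure states as rank-one matrices. -/

/-- The rank-one matrix `|v⟩⟨v|`. -/
noncomputable def rankOne {d : ℕ} (v : EuclideanSpace ℂ (Fin d)) : Matrix (Fin d) (Fin d) ℂ :=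
  Matrix.vecMulVec v (star (v : Fin d → ℂ))

theorem continuous_rankOne (d : ℕ) : Continuous (rankOne (d := d)) := by
  refine continuous_matrix fun i j => ?_
  simp only [rankOne, Matrix.vecMulVec_apply, Pi.star_apply]
  fun_prop

theorem continuous_rankOne_unitary {d : ℕ} (v : EuclideanSpace ℂ (Fin d)) :
    Continuous fun V : Matrix.unitaryGroup (Fin d) ℂ =>
      rankOne (Matrix.toEuclideanLin (V : Matrix (Fin d) (Fin d) ℂ) v) := by
  have h : Continuous fun V : Matrix.unitaryGroup (Fin d) ℂ =>
      Matrix.toEuclideanLin (V : Matrix (Fin d) (Fin d) ℂ) v := by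
    simp only [Matrix.toLpLin_apply]
    exact (PiLp.continuous_toLp 2 _).comp (continuous_subtype_val.matrix_mulVec continuous_const)
  exact (continuous_rankOne d).comp h

theorem rankOne_smul {d : ℕ} {c : ℂ} (hc : ‖c‖ = 1) (v : EuclideanSpace ℂ (Fin d)) :
    rankOne (c • v) = rankOne v := by
  ext i j
  have h : c * star c = 1 := by
    rw [← starRingEnd_apply, Complex.mul_conj, Complex.normSq_eq_norm_sq, hc]; simp
  simp only [rankOne, Matrix.vecMulVec_apply, Pi.star_apply, PiLp.smul_apply, smul_eq_mul, star_mul']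
  linear_combination (v i * star (v j)) * h

/-- Applying both projectors to `v` gives $v=\langle w,v\rangle w$. -/
theorem exists_eq_smul_of_rankOne_eq {d : ℕ} {v w : EuclideanSpace ℂ (Fin d)} (hv : ‖v‖ = 1)
    (h : rankOne v = rankOne w) : ∃ c : ℂ, v = c • w := by
  refine ⟨∑ j, star (w j) * v j, ?_⟩
  have h1 : ∑ j, star (v j) * v j = 1 := by
    have := EuclideanSpace.norm_sq_eq v
    rw [hv] at this
    have h2 : ∀ j, star (v j) * v j = ((‖v j‖ ^ 2 : ℝ) : ℂ) := fun j => by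
      rw [← starRingEnd_apply, mul_comm, Complex.mul_conj, Complex.normSq_eq_norm_sq]
    simp_rw [h2]
    rw [← Complex.ofReal_sum, ← this]
    simp
  ext i
  have hij (j : Fin d) : v i * star (v j) = w i * star (w j) := congr_fun (congr_fun h i) j
  calc v i = v i * ∑ j, star (v j) * v j := by rw [h1, mul_one]
    _ = ∑ j, v i * star (v j) * v j := by rw [Finset.mul_sum]; simp_rw [mul_assoc]
    _ = ∑ j, w i * star (w j) * v j := by simp_rw [hij]
    _ = _ := by
      rw [PiLp.smul_apply, smul_eq_mul, mul_comm, Finset.mul_sum]; simp_rw [mul_assoc]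

/-- The pure state of a unit vector. -/
noncomputable def PureState.ofUnit {d : ℕ} (v : EuclideanSpace ℂ (Fin d)) (hv : ‖v‖ = 1) :
    PureState d := ⟨rankOne v, v, hv, rfl⟩

theorem PureState.conj_ofUnit_val {d : ℕ} (V : Matrix.unitaryGroup (Fin d) ℂ)
    (v : EuclideanSpace ℂ (Fin d)) (hv : ‖v‖ = 1) :
    (PureState.conj V (PureState.ofUnit v hv)).1 =
      rankOne (Matrix.toEuclideanLin (V : Matrix (Fin d) (Fin d) ℂ) v) := by
  simp only [PureState.conj, PureState.ofUnit, rankOne]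
  rw [Matrix.mul_vecMulVec, Matrix.vecMulVec_mul]
  simp [Matrix.toLpLin_apply, Matrix.star_mulVec, Matrix.star_eq_conjTranspose]

theorem PureState.continuous_val (d : ℕ) : Continuous fun ψ : PureState d => ψ.1 :=
  continuous_subtype_val

/-! ### Smooth pieces, cones and closed sets of states. -/

/-- A piecewise-smooth function on the torus is continuous on a nonempty open set, on which it takes
values in the image of a smooth map on an open subset of `ℝ^m`. -/
theorem PiecewiseSmooth.exists_isOpen {m : ℕ} {E : Type*} [NormedAddCommGroup E] [NormedSpace ℝ E]
    {f : Torus m → E} (hf : PiecewiseSmooth f) :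
    ∃ B : Set (Torus m), IsOpen B ∧ B.Nonempty ∧ ContinuousOn f B ∧
      ∃ (W : Set (Fin m → ℝ)) (g : (Fin m → ℝ) → E), IsOpen W ∧ ContDiffOn ℝ (⊤ : ℕ∞) g W ∧
        ∀ θ ∈ B, ∃ x ∈ W, f θ = g x := by
  obtain ⟨A, hA, hfr, hsm⟩ := hf
  have hq : IsOpenQuotientMap (toTorus (m := m)) :=
    IsOpenQuotientMap.piMap (f := fun (_ : Fin m) (x : ℝ) => (x : AddCircle (2 * Real.pi)))
      fun _ => QuotientAddGroup.isOpenQuotientMap_mk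
  have hne : ∃ i, (interior (A i)).Nonempty := by
    -- A piece with empty interior lies in its own null frontier, and countably many such pieces
    -- cannot cover the torus.
    by_contra! h
    have huniv : (volume : Measure (Torus m)) Set.univ ≤ 0 := by
      rw [← hA]
      refine (measure_iUnion_null fun i => ?_).le
      refine measure_mono_null (fun x hx => ?_) (hfr i)
      rw [frontier, h i, Set.sdiff_empty]
      exact subset_closure hx
    exact (isOpen_univ.measure_pos volume ⟨0, trivial⟩).not_ge huniv
  obtain ⟨i, hi⟩ := hne
  obtain ⟨W, g, hW, hAW, hg, hfg⟩ := hsm i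
  refine ⟨interior (A i), isOpen_interior, hi, fun θ hθ => ContinuousAt.continuousWithinAt ?_,
    W, g, hW, hg, fun θ hθ => ?_⟩
  · obtain ⟨x, rfl⟩ := hq.surjective θ
    have hx : toTorus x ∈ A i := interior_subset hθ
    -- The covering map is an open quotient map, so continuity can be checked upstairs, where `g` is
    -- available.
    rw [← hq.continuousAt_comp_iff]
    refine (hg.continuousOn.continuousAt (hW.mem_nhds (hAW hx))).congr ?_
    filter_upwards [hq.continuous.continuousAt.preimage_mem_nhds (isOpen_interior.mem_nhds hθ)]
      with y hy using (hfg y (interior_subset hy)).symm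
  · obtain ⟨x, rfl⟩ := hq.surjective θ
    have hx : toTorus x ∈ A i := interior_subset hθ
    exact ⟨x, hAW hx, hfg x hx⟩

/-- The cone is $\sigma$-compact: exhaust the scalars by closed balls. -/
theorem measurableSet_cone {E : Type*} [NormedAddCommGroup E] [NormedSpace ℂ E] [MeasurableSpace E]
    [BorelSpace E] {S : Set E} (hS : IsCompact S) :
    MeasurableSet ((fun p : ℂ × E => p.1 • p.2) '' (Set.univ ×ˢ S)) := by
  rw [← Metric.iUnion_closedBall_nat (0 : ℂ), Set.iUnion_prod_const, Set.image_iUnion]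
  exact MeasurableSet.iUnion fun n =>
    (((isCompact_closedBall _ _).prod hS).image continuous_smul).measurableSet

theorem exists_continuous_approx_of_isClosed {X : Type*} [PseudoEMetricSpace X] {K : Set X}
    (hK : IsClosed K) :
    ∃ G : ℕ → C(X, ℝ), (∀ n x, 0 ≤ G n x) ∧ (∀ n x, G n x ≤ 1) ∧ (∀ n, ∀ x ∈ K, G n x = 1) ∧
      ∀ x ∉ K, Tendsto (fun n => G n x) atTop (𝓝 0) := by
  have hδ (n : ℕ) : (0 : ℝ) < 1 / ((n : ℝ) + 1) := by positivity
  refine ⟨fun n => ⟨fun x => (thickenedIndicator (hδ n) K x : ℝ),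
    NNReal.continuous_coe.comp (thickenedIndicator (hδ n) K).continuous⟩, fun n x => ?_,
    fun n x => ?_, fun n x hx => ?_, fun x hx => ?_⟩
  · exact NNReal.coe_nonneg _
  · exact NNReal.coe_le_one.2 (thickenedIndicator_le_one (hδ n) K x)
  · exact NNReal.coe_eq_one.2 (thickenedIndicator_one (hδ n) K hx)
  · have h := tendsto_pi_nhds.1 (thickenedIndicator_tendsto_indicator_closure hδ
      tendsto_one_div_add_atTop_nhds_zero_nat K) x
    rw [hK.closure_eq, Set.indicator_of_notMem hx] at h
    exact (NNReal.continuous_coe.tendsto 0).comp h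

/-- If the orbit of some state spends a positive fraction of time in a closed set of states, while
the orbit of some state under a Haar-random unitary almost surely avoids it,
then there is no complete Hilbert-space ergodicity. -/
theorem not_exhibitsCHSE_of_isClosed {d : ℕ} {U : ℝ → Matrix.unitaryGroup (Fin d) ℂ}
    (hU : Continuous U) {K : Set (Matrix (Fin d) (Fin d) ℂ)} (hK : IsClosed K)
    {v w : EuclideanSpace ℂ (Fin d)}
    (hv : ‖v‖ = 1) (hw : ‖w‖ = 1)
    (hVK : ∀ᵐ V : Matrix.unitaryGroup (Fin d) ℂ ∂haarUnitary d,
      rankOne (Matrix.toEuclideanLin (V : Matrix (Fin d) (Fin d) ℂ) w) ∉ K)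
    {χ : ℝ → ℝ} (hχ : Continuous χ) (hχ1 : ∀ t, χ t ≤ 1)
    (hχK : ∀ t, rankOne (Matrix.toEuclideanLin (U t : Matrix (Fin d) (Fin d) ℂ) v) ∉ K → χ t ≤ 0)
    {c : ℝ} (hc : 0 < c) (hlim : Tendsto (fun T : ℝ => T⁻¹ * ∫ t in (0 : ℝ)..T, χ t) atTop (𝓝 c)) :
    ¬ ExhibitsCHSE U := by
  intro hE
  obtain ⟨G, hG0, hG1, hGK, hGlim⟩ : ∃ G : ℕ → C(Matrix (Fin d) (Fin d) ℂ, ℝ),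
      (∀ n x, 0 ≤ G n x) ∧ (∀ n x, G n x ≤ 1) ∧ (∀ n, ∀ x ∈ K, G n x = 1) ∧
      ∀ x ∉ K, Tendsto (fun n => G n x) atTop (𝓝 0) :=
    -- Matrices have the product topology, so the sup metric of the function space supplies the
    -- thickenings.
    exists_continuous_approx_of_isClosed (X := Fin d → Fin d → ℂ) hK
  let F (n : ℕ) : C(PureState d, ℝ) :=
    ⟨fun ψ => G n ψ.1, (G n).continuous.comp (PureState.continuous_val d)⟩
  have hV := continuous_rankOne_unitary w
  have hUt : Continuous fun t : ℝ =>
      rankOne (Matrix.toEuclideanLin (U t : Matrix (Fin d) (Fin d) ℂ) v) :=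
    (continuous_rankOne_unitary v).comp hU
  -- Along the orbit `χ ≤ G n`, so ergodicity pushes `c` below every spatial average; these tend to
  -- zero by dominated convergence.
  have hlower (n : ℕ) : c ≤ spatialAverage (PureState.ofUnit w hw) (F n) := by
    refine le_of_tendsto_of_tendsto hlim
      (hE (PureState.ofUnit v hv) (PureState.ofUnit w hw) (F n)) ?_
    filter_upwards [eventually_gt_atTop 0] with T hT
    simp only [timeAverage, F, ContinuousMap.coe_mk, PureState.conj_ofUnit_val]
    refine mul_le_mul_of_nonneg_left ?_ (inv_nonneg.2 hT.le)
    refine intervalIntegral.integral_mono_on hT.le (hχ.intervalIntegrable _ _)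
      (((G n).continuous.comp hUt).intervalIntegrable _ _) fun t _ => ?_
    by_cases ht : rankOne (Matrix.toEuclideanLin (U t : Matrix (Fin d) (Fin d) ℂ) v) ∈ K
    · exact (hχ1 t).trans_eq (hGK n _ ht).symm
    · exact (hχK t ht).trans (hG0 n _)
  have hzero : Tendsto (fun n => spatialAverage (PureState.ofUnit w hw) (F n)) atTop (𝓝 0) := by
    simp only [spatialAverage, F, ContinuousMap.coe_mk, PureState.conj_ofUnit_val]
    rw [← integral_zero (Matrix.unitaryGroup (Fin d) ℂ) ℝ (μ := haarUnitary d)]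
    refine tendsto_integral_of_dominated_convergence (fun _ => 1)
      (fun n => ((G n).continuous.comp hV).aestronglyMeasurable) (integrable_const _)
      (fun n => Eventually.of_forall fun V => ?_) ?_
    · rw [Real.norm_of_nonneg (hG0 n _)]
      exact hG1 n _
    · filter_upwards [hVK] with V hV using hGlim _ hV
  exact hc.not_ge (ge_of_tendsto' hzero hlower)

end QuantumErgodicity

/-! ### The main theorem. -/

open QuantumErgodicity
theorem theorem2 (d m : ℕ) (hm : m < 2 * (d - 1))
    (H : ℝ → Matrix (Fin d) (Fin d) ℂ) (ω : Fin m → ℝ) (hH : IsTimeQuasiperiodic H ω)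
    (U : ℝ → Matrix.unitaryGroup (Fin d) ℂ) (hU : IsEvolutionOperator H U)
    (q : ℝ) (α : Torus m → EuclideanSpace ℂ (Fin d)) (hα : IsQuasienergyEigenstate U ω q α) :
    ¬ ExhibitsCHSE U := by
  obtain ⟨⟨_, hω, -⟩, -⟩ := hH
  obtain ⟨B, hBo, hBne, hαB, W, g, hW, hg, hBW⟩ := hα.piecewiseSmooth.exists_isOpen
  obtain ⟨C, hCB, hC, χ, hχ, hχ1, hχC, c, hc, hlim⟩ := exists_bump_average_winding hω hBo hBne
  have hS : IsCompact (α '' C) := hC.image_of_continuousOn (hαB.mono hCB)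
  have hnull : MeasureTheory.Measure.hausdorffMeasure (2 * d : ℕ)
      ((fun p : ℂ × EuclideanSpace ℂ (Fin d) => p.1 • p.2) '' (Set.univ ×ˢ (α '' C))) = 0 := by
    -- The hypothesis forces $d\ge 2$ despite truncated subtraction, and then reads $m+2<2d$.
    refine MeasureTheory.measure_mono_null ?_
      (hausdorffMeasure_cone_eq_zero hW hg (k := 2 * d) (by omega))
    rintro _ ⟨⟨a, _⟩, ⟨-, θ, hθ, rfl⟩, rfl⟩
    obtain ⟨x, hx, hθx⟩ := hBW θ (hCB hθ)
    exact ⟨(a, x), ⟨trivial, hx⟩, by simp only [hθx]⟩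
  obtain ⟨v, hv0, hv⟩ := exists_ae_unitary_notMem (by omega) (measurableSet_cone hS) hnull
  have hw : ‖((‖v‖⁻¹ : ℝ) : ℂ) • v‖ = 1 := by
    rw [norm_smul, Complex.norm_real, norm_inv, norm_norm, inv_mul_cancel₀ (norm_ne_zero_iff.2 hv0)]
  refine not_exhibitsCHSE_of_isClosed hU.continuous
    (hS.image (continuous_rankOne d)).isClosed (hα.norm_eq_one 0) hw ?_
    (hχ.comp (continuous_winding ω)) (fun t => hχ1 _) (fun t ht => (hχC _ fun hmem => ht ?_).le)
    hc hlim
  -- A normalised image with state in the closed set is a multiple of some `α θ`; rescaling by `‖v‖`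
  -- would put the image of `v` in the cone.
  · filter_upwards [hv] with V hV hmem
    obtain ⟨_, ⟨θ, hθ, rfl⟩, heq⟩ := hmem
    have hnorm := (AddMonoidHomClass.isometry_iff_norm _).1 (isometry_toEuclideanLin V)
      (((‖v‖⁻¹ : ℝ) : ℂ) • v)
    obtain ⟨a, ha⟩ := exists_eq_smul_of_rankOne_eq (hnorm.trans hw) heq.symm
    refine hV ⟨((‖v‖ : ℂ) * a, α θ), ⟨trivial, θ, hθ, rfl⟩, ?_⟩
    have hvn : (‖v‖ : ℂ) ≠ 0 := by exact_mod_cast norm_ne_zero_iff.2 hv0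
    simp only [mul_smul, ← ha, map_smul, Complex.ofReal_inv]
    rw [smul_inv_smul₀ hvn]
  · refine ⟨α (winding ω t), ⟨_, hmem, rfl⟩, ?_⟩
    -- The quasienergy phase has modulus one and disappears from the projector.
    rw [hα.evolution t, rankOne_smul]
    have : -(Complex.I * q * t) = ((-(q * t) : ℝ) : ℂ) * Complex.I := by push_cast; ring
    rw [this, Complex.norm_exp_ofReal_mul_I]
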